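/- Let $n\ge 1$, let $\Omega\subset\mathbb C^n$ be a bounded pseudoconvex domain, let $\delta(z)$ be the Euclidean distance from $z$ to $\partial\Omega$, and put $\Omega_t=\{z\in\Omega:\delta(z)>t\}$ for $t>0$. Let $\overline B\subset\Omega$ be a closed ball of positive radius, and let $$\varrho(z)=\sup\{u(z): u \text{ a negative plurisubharmonic function on } \Omega,\ u\le -1 \text{ on } \overline B\},\qquad z\in\Omega,$$ be its relative extremal function. Suppose that there are numbers $0<\alpha<1$, $t_0>0$ and a family $\{\psi_t\}_{0<t\le t_0}$ of plurisubharmonic functions on $\Omega$ such that, for all $0<t\le t_0$, $$\sup_\Omega\psi_t<1\qquad\text{and}\qquad \inf_{\Omega\setminus\Omega_{\alpha t}}\psi_t>\sup_{\partial\Omega_t}\psi_t .$$ Put $$\kappa_\alpha(t)=\frac{\inf_{\Omega\setminus\Omega_{\alpha t}}\psi_t-\sup_{\partial\Omega_t}\psi_t}{1-\sup_{\partial\Omega_t}\psi_t}.$$ Let $0<r_0\le t_0$ be so small that $\overline B\subset\Omega_{r_0}$, let $r>0$ satisfy $r/\alpha<r_0$, and assume that $\kappa_\alpha$ is Lebesgue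 measurable on $(r/\alpha,r_0]$. Then $\kappa_\alpha(t)/t$ is integrable on $[r/\alpha,r_0]$ and $$\sup_{\Omega\setminus\Omega_r}(-\varrho)\le\exp\left[-\frac1{\log(1/\alpha)}\int_{r/\alpha}^{r_0}\frac{\kappa_\alpha(t)}t\,dt\right].$$ -/

import Mathlib

open MeasureTheory

noncomputable section

namespace PSH

/-- The integral mean over `(0, 2π]` of an extended-real function, as the difference of the integrals
of its positive and negative parts. (It is applied to functions that are bounded above, so that the
first of the two integrals is finite and the mean is a well-defined element of `[-∞, ∞)`.) -/
def circleMean (f : ℝ → EReal) : EReal :=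
  (((∫⁻ θ in Set.Ioc 0 (2 * Real.pi), (f θ).toENNReal : ENNReal) : EReal)
    - ((∫⁻ θ in Set.Ioc 0 (2 * Real.pi), (-f θ).toENNReal : ENNReal) : EReal))
    / ((2 * Real.pi : ℝ) : EReal)

/-- `u : Ω → [-∞, ∞)` is plurisubharmonic on the open set `Ω ⊆ ℂⁿ`: it is upper semicontinuous and
satisfies the sub-mean-value inequality on every closed disc `{a + ζ b : |ζ| ≤ 1}` in `Ω` that lies
in a complex line. Only the values of `u` on `Ω` matter. -/
structure IsPsh {n : ℕ} (u : EuclideanSpace ℂ (Fin n) → EReal)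
    (Ω : Set (EuclideanSpace ℂ (Fin n))) : Prop where
  lt_top : ∀ z ∈ Ω, u z < ⊤
  usc : UpperSemicontinuousOn u Ω
  submean : ∀ a b : EuclideanSpace ℂ (Fin n),
    (∀ ζ : ℂ, ‖ζ‖ ≤ 1 → a + ζ • b ∈ Ω) →
      u a ≤ circleMean (fun θ => u (a + Complex.exp (θ * Complex.I) • b))

/-- Pseudoconvexity of an open set: existence of a continuous plurisubharmonic exhaustion
function, whose sublevel sets are relatively compact in `Ω`. -/
def IsPseudoconvex {n : ℕ} (Ω : Set (EuclideanSpace ℂ (Fin n))) : Prop :=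
  ∃ φ : EuclideanSpace ℂ (Fin n) → ℝ, ContinuousOn φ Ω ∧ IsPsh (fun z => (φ z : EReal)) Ω ∧
    ∀ c : ℝ, ∃ K : Set (EuclideanSpace ℂ (Fin n)), IsCompact K ∧ K ⊆ Ω ∧ {z ∈ Ω | φ z < c} ⊆ K

/-- `Ω_t = {z ∈ Ω : δ(z) > t}`, where `δ` is the Euclidean distance to the boundary of `Ω`. -/
def inner {n : ℕ} (Ω : Set (EuclideanSpace ℂ (Fin n))) (t : ℝ) :
    Set (EuclideanSpace ℂ (Fin n)) :=
  {z ∈ Ω | t < Metric.infDist z (frontier Ω)}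

/-- The relative extremal function of `K` in `Ω`: the pointwise supremum of the negative
plurisubharmonic functions on `Ω` that are at most `-1` on `K`. -/
def relExtremal {n : ℕ} (Ω K : Set (EuclideanSpace ℂ (Fin n)))
    (z : EuclideanSpace ℂ (Fin n)) : EReal :=
  sSup {x : EReal | ∃ u : EuclideanSpace ℂ (Fin n) → EReal,
    IsPsh u Ω ∧ (∀ w ∈ Ω, u w < 0) ∧ (∀ w ∈ K, u w ≤ -1) ∧ u z = x}

/-- `inf` of `ψ_t` over `Ω \ Ω_{αt}`. -/
def outerInf {n : ℕ} (Ω : Set (EuclideanSpace ℂ (Fin n))) (α : ℝ)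
    (ψ : ℝ → EuclideanSpace ℂ (Fin n) → EReal) (t : ℝ) : EReal :=
  ⨅ z ∈ Ω \ inner Ω (α * t), ψ t z

/-- `sup` of `ψ_t` over `∂Ω_t`. -/
def bdrySup {n : ℕ} (Ω : Set (EuclideanSpace ℂ (Fin n)))
    (ψ : ℝ → EuclideanSpace ℂ (Fin n) → EReal) (t : ℝ) : EReal :=
  ⨆ z ∈ frontier (inner Ω t), ψ t z

/-- The normalized gap `κ_α(t)`. (Both extended reals are finite for the `t` at which it is used.) -/
def kappa {n : ℕ} (Ω : Set (EuclideanSpace ℂ (Fin n))) (α : ℝ)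
    (ψ : ℝ → EuclideanSpace ℂ (Fin n) → EReal) (t : ℝ) : ℝ :=
  ((outerInf Ω α ψ t).toReal - (bdrySup Ω ψ t).toReal) / (1 - (bdrySup Ω ψ t).toReal)

end PSH

end

/-! Let `D t` be the supremum of `-ϱ` over `Ω \ Ω_t`, and let `S`, `I` be the supremum and infimum
entering `κ(t)`. The function `D t * (ψ_t - 1) / (1 - S)` is at most `-D t ≤ ϱ` on `∂Ω_t` and at
most `0` on `Ω`. Taking its maximum with the regularization `ϱ*` outside `Ω_t`, and `ϱ*` inside,
gives a competitor for `ϱ`. Evaluated on `Ω \ Ω_{αt}` it yields `D (α t) ≤ D t * (1 - κ(t))`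
(`relExtremal_ge_of_gap`). Hence `κ(t) ≤ log D(t) - log D(αt)`; integrated against `dt/t`, the right
side telescopes to two short intervals, where `D ≤ 1` and the monotonicity of `D` suffice
(`log_integral_bound`).

The potential theory behind this: gluing gives the sub-mean inequality only on small discs, so it
must be extended to all discs (`le_discMean_of_local_submean`). Further, `ϱ*` must be
plurisubharmonic (`extremalReg_isBddPsh`), at most `-1` on the whole closed ball
(`IsBddPsh.le_on_closedBall`) and strictly negative (`IsBddPsh.lt_of_isPreconnected`), so that `log
D` makes sense. -/

namespace PSH

open Set Filter Topology

noncomputable section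

/-- The mean of a real function over the circle `{a + ζ b : |ζ| = 1}`. -/
def discMean {E : Type*} [AddCommGroup E] [Module ℂ E] (u : E → ℝ) (a b : E) : ℝ :=
  (2 * Real.pi)⁻¹ * ∫ θ in Ioc 0 (2 * Real.pi), u (a + Complex.exp (θ * Complex.I) • b)

/-! ### Circle means of bounded semicontinuous functions -/

section CircleMeans

variable {E : Type*} [NormedAddCommGroup E] [NormedSpace ℂ E]

lemma continuous_circle (a b : E) :
    Continuous fun θ : ℝ => a + Complex.exp (θ * Complex.I) • b := by
  fun_prop

lemma upperSemicontinuous_circle {u : E → ℝ} {Ω : Set E} (hu : UpperSemicontinuousOn u Ω) {a b : E}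
    (h : ∀ θ : ℝ, a + Complex.exp (θ * Complex.I) • b ∈ Ω) :
    UpperSemicontinuous fun θ : ℝ => u (a + Complex.exp (θ * Complex.I) • b) := by
  rw [← upperSemicontinuousOn_univ_iff]
  exact hu.comp (continuous_circle a b).continuousOn fun θ _ => h θ

lemma integrableOn_of_usc_of_bdd {f : ℝ → ℝ} (hf : UpperSemicontinuous f) {C : ℝ}
    (hC : ∀ θ, |f θ| ≤ C) : IntegrableOn f (Ioc 0 (2 * Real.pi)) := by
  refine Measure.integrableOn_of_bounded (M := C) measure_Ioc_lt_top.ne hf.measurable.aestronglyMeasurable ?_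
  exact Eventually.of_forall fun θ => hC θ

lemma mean_const (m : ℝ) : (2 * Real.pi)⁻¹ * ∫ _ in Ioc 0 (2 * Real.pi), m = m := by
  have hpi := Real.two_pi_pos
  rw [setIntegral_const, Real.volume_real_Ioc_of_le hpi.le, sub_zero, smul_eq_mul,
    inv_mul_cancel_left₀ hpi.ne']

/-- The set `{f < m}` is open, so it meets the open interval in positive measure even when `θ₀` is
an endpoint. -/
lemma integral_lt_of_usc {f : ℝ → ℝ} (hf : UpperSemicontinuous f) {C m : ℝ} (hC : ∀ θ, |f θ| ≤ C)
    (hm : ∀ θ, f θ ≤ m) {θ₀ : ℝ} (hθ₀ : θ₀ ∈ Icc 0 (2 * Real.pi)) (hlt : f θ₀ < m) :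
    (2 * Real.pi)⁻¹ * ∫ θ in Ioc 0 (2 * Real.pi), f θ < m := by
  have hpi := Real.two_pi_pos
  have hint := integrableOn_of_usc_of_bdd hf hC
  have hopen : IsOpen {θ | f θ < m} := hf.isOpen_preimage m
  have hne : ({θ | f θ < m} ∩ Ioo 0 (2 * Real.pi)).Nonempty := by
    rw [← closure_Ioo hpi.ne] at hθ₀
    exact mem_closure_iff.1 hθ₀ _ hopen hlt
  have hpos : 0 < volume ({θ | f θ < m} ∩ Ioo 0 (2 * Real.pi)) :=
    (hopen.inter isOpen_Ioo).measure_pos _ hne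
  have hi : IntegrableOn (fun θ => m - f θ) (Ioc 0 (2 * Real.pi)) :=
    (integrableOn_const measure_Ioc_lt_top.ne).sub hint
  have key : 0 < ∫ θ in Ioc 0 (2 * Real.pi), (m - f θ) := by
    rw [setIntegral_pos_iff_support_of_nonneg_ae
      (Eventually.of_forall fun θ => sub_nonneg.2 (hm θ)) hi]
    refine hpos.trans_le (measure_mono ?_)
    rintro θ ⟨h1, h2⟩
    exact ⟨(sub_pos.2 h1).ne', Ioo_subset_Ioc_self h2⟩
  rw [integral_sub (integrable_const m) hint] at key
  have hc := mean_const m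
  rw [← mul_lt_mul_iff_right₀ (inv_pos.2 hpi), mul_zero, mul_sub, hc] at key
  linarith

lemma circle_mem {Ω : Set E} {a b : E} (h : ∀ ζ : ℂ, ‖ζ‖ ≤ 1 → a + ζ • b ∈ Ω) (θ : ℝ) :
    a + Complex.exp (θ * Complex.I) • b ∈ Ω :=
  h _ (Complex.norm_exp_ofReal_mul_I θ).le

lemma discMean_integrable {u : E → ℝ} {Ω : Set E} (hu : UpperSemicontinuousOn u Ω) {C : ℝ}
    (hC : ∀ z ∈ Ω, |u z| ≤ C) {a b : E} (h : ∀ θ : ℝ, a + Complex.exp (θ * Complex.I) • b ∈ Ω) :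
    IntegrableOn (fun θ : ℝ => u (a + Complex.exp (θ * Complex.I) • b)) (Ioc 0 (2 * Real.pi)) :=
  integrableOn_of_usc_of_bdd (upperSemicontinuous_circle hu h) fun θ => hC _ (h θ)

lemma mean_mono {f g : ℝ → ℝ} (hf : IntegrableOn f (Ioc 0 (2 * Real.pi)))
    (hg : IntegrableOn g (Ioc 0 (2 * Real.pi))) (h : ∀ θ, f θ ≤ g θ) :
    (2 * Real.pi)⁻¹ * ∫ θ in Ioc 0 (2 * Real.pi), f θ ≤
      (2 * Real.pi)⁻¹ * ∫ θ in Ioc 0 (2 * Real.pi), g θ :=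
  mul_le_mul_of_nonneg_left (integral_mono hf hg h) (by positivity)

lemma discMean_re_of_differentiable {P : ℂ → ℂ} (hP : Differentiable ℂ P) (a b : ℂ) :
    discMean (fun z => (P z).re) a b = (P a).re := by
  have h1 : Differentiable ℂ (fun ζ : ℂ => P (a + ζ * b)) := by fun_prop
  have h2 := (h1.diffContOnCl (s := Metric.ball 0 |1|)).circleAverage
  rw [Real.circleAverage, intervalIntegral.integral_of_le Real.two_pi_pos.le] at h2
  have h3 : IntegrableOn (fun θ : ℝ => P (a + circleMap 0 1 θ * b)) (Ioc 0 (2 * Real.pi)) := by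
    have : Continuous (fun θ : ℝ => P (a + circleMap 0 1 θ * b)) :=
      hP.continuous.comp (by fun_prop)
    exact (this.integrableOn_Icc (a := 0) (b := 2 * Real.pi)).mono_set Ioc_subset_Icc_self
  have h4 := congrArg Complex.re h2
  rw [Complex.smul_re, ← RCLike.re_eq_complex_re, ← integral_re h3] at h4
  simpa [discMean, circleMap] using h4

end CircleMeans

/-! ### One variable: from small discs to the unit disc -/

section OneVariable

/-- Maximum principle: an upper semicontinuous function on the closed unit disc that satisfies the
local sub-mean-value inequality is bounded by its bound on the unit circle. -/
lemma le_of_local_submean {w : ℂ → ℝ} (hw : UpperSemicontinuousOn w (Metric.closedBall 0 1))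
    {C : ℝ} (hC : ∀ z ∈ Metric.closedBall (0 : ℂ) 1, |w z| ≤ C)
    (hloc : ∀ z ∈ Metric.ball (0 : ℂ) 1, ∃ ρ > 0, ∀ s : ℝ, 0 < s → s < ρ →
      w z ≤ discMean w z (s : ℂ)) {m : ℝ} (hbd : ∀ z ∈ Metric.sphere (0 : ℂ) 1, w z ≤ m) :
    ∀ z ∈ Metric.closedBall (0 : ℂ) 1, w z ≤ m := by
  have hcpt : IsCompact (Metric.closedBall (0 : ℂ) 1) := isCompact_closedBall 0 1
  obtain ⟨p, hp, hpmax⟩ := hw.exists_isMaxOn ⟨0, by simp⟩ hcpt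
  by_contra! hcon
  obtain ⟨q, hq, hqm⟩ := hcon
  have hpm : m < w p := hqm.trans_le (hpmax hq)
  -- Among the maximum points one with largest real part is chosen: small circles around it leave
  -- the maximum set at `θ = 0`, so their means are strictly smaller.
  have hK : IsCompact (Metric.closedBall (0 : ℂ) 1 ∩ w ⁻¹' Ici (w p)) :=
    hw.isCompact_inter_preimage_Ici hcpt _
  obtain ⟨z, ⟨hz, hzp⟩, hzmax⟩ := hK.exists_isMaxOn ⟨p, hp, le_refl (w p)⟩
    Complex.continuous_re.continuousOn
  have hzball : z ∈ Metric.ball (0 : ℂ) 1 := by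
    rcases (mem_closedBall_zero_iff.1 hz).lt_or_eq with h | h
    · simpa using h
    · exact absurd (hbd z (by simpa using h)) (not_le.2 (hpm.trans_le hzp))
  obtain ⟨ρ, hρ, hsub⟩ := hloc z hzball
  have hz1 : ‖z‖ < 1 := by simpa using hzball
  set s : ℝ := min ρ (1 - ‖z‖) / 2 with hs
  have hmin : 0 < min ρ (1 - ‖z‖) := lt_min hρ (by linarith)
  have hs0 : 0 < s := by positivity
  have hsρ : s < ρ := by have := min_le_left ρ (1 - ‖z‖); linarith
  have hs1 : s < 1 - ‖z‖ := by have := min_le_right ρ (1 - ‖z‖); linarith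
  have hcirc : ∀ θ : ℝ, z + Complex.exp (θ * Complex.I) • (s : ℂ) ∈ Metric.closedBall (0 : ℂ) 1 := by
    intro θ
    rw [mem_closedBall_zero_iff]
    refine (norm_add_le _ _).trans ?_
    rw [norm_smul, Complex.norm_exp_ofReal_mul_I, Complex.norm_real, Real.norm_of_nonneg hs0.le]
    linarith
  have hstrict : w (z + Complex.exp ((0 : ℝ) * Complex.I) • (s : ℂ)) < w p := by
    by_contra! h
    have := hzmax ⟨hcirc 0, h⟩
    simp at this
    linarith
  have := integral_lt_of_usc (upperSemicontinuous_circle hw hcirc) (fun θ => hC _ (hcirc θ))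
    (fun θ => hpmax (hcirc θ)) (θ₀ := 0) ⟨le_rfl, Real.two_pi_pos.le⟩ hstrict
  have h2 : w p ≤ w z := hzp
  exact absurd (h2.trans (hsub s hs0 hsρ)) (not_le.2 this)

/-- A bounded upper semicontinuous function on a metric space is, up to an arbitrarily small error in
the integral, below a bounded continuous function. -/
lemma exists_continuous_ge_integral_lt {X : Type*} [PseudoMetricSpace X] [MeasurableSpace X]
    [BorelSpace X] (μ : Measure X) [IsFiniteMeasure μ] {F : X → ℝ} (hF : UpperSemicontinuous F)
    {C : ℝ} (hC : ∀ x, |F x| ≤ C) {ε : ℝ} (hε : 0 < ε) :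
    ∃ g : X → ℝ, Continuous g ∧ (∀ x, F x ≤ g x) ∧ (∀ x, |g x| ≤ C) ∧
      ∫ x, g x ∂μ < ∫ x, F x ∂μ + ε := by
  -- Sup-convolutions of `F`: `g k` is `k`-Lipschitz and tends to `F` pointwise by upper
  -- semicontinuity.
  set g : ℕ → X → ℝ := fun k x => ⨆ y, (F y - k * dist x y) with hg
  have hbdd : ∀ (k : ℕ) x, BddAbove (range fun y => F y - k * dist x y) := by
    rintro k x
    refine ⟨C, ?_⟩
    rintro _ ⟨y, rfl⟩
    have h1 := (abs_le.1 (hC y)).2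
    have h2 : 0 ≤ (k : ℝ) * dist x y := by positivity
    simp only
    linarith
  have hFg : ∀ k x, F x ≤ g k x := fun k x => by
    simpa using le_ciSup (hbdd k x) x
  have hgC : ∀ k x, |g k x| ≤ C := fun k x => by
    have : Nonempty X := ⟨x⟩
    refine abs_le.2 ⟨(abs_le.1 (hC x)).1.trans (hFg k x), ciSup_le fun y => ?_⟩
    have h1 := (abs_le.1 (hC y)).2
    have h2 : 0 ≤ (k : ℝ) * dist x y := by positivity
    linarith
  have hcont : ∀ k, Continuous (g k) := fun k => by
    refine (LipschitzWith.of_le_add_mul (K := k) fun x x' => ?_).continuous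
    have : Nonempty X := ⟨x⟩
    refine ciSup_le fun y => ?_
    have h1 := le_ciSup (hbdd k x') y
    have h2 : (k : ℝ) * dist x' y ≤ k * (dist x x' + dist x y) := by
      gcongr
      rw [dist_comm x x']
      exact dist_triangle _ _ _
    simp only [NNReal.coe_natCast] at *
    change _ ≤ g k x' + _
    change _ ≤ g k x' at h1
    linarith
  have hlim : ∀ x, Tendsto (fun k => g k x) atTop (𝓝 (F x)) := by
    intro x
    have : Nonempty X := ⟨x⟩
    refine tendsto_order.2 ⟨fun c hc => Eventually.of_forall fun k => hc.trans_le (hFg k x),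
      fun c hc => ?_⟩
    obtain ⟨c', hc1, hc2⟩ := exists_between hc
    obtain ⟨δ, hδ, hball⟩ := Metric.eventually_nhds_iff.1 (hF x c' hc1)
    -- For `k ≥ N`, points at distance at least `δ` contribute at most `C - N * δ < c'`.
    obtain ⟨N, hN⟩ := exists_nat_gt ((C - c') / δ)
    filter_upwards [eventually_ge_atTop N] with k hk
    refine lt_of_le_of_lt (ciSup_le fun y => ?_) hc2
    by_cases hy : dist y x < δ
    · have := hball hy
      have h2 : 0 ≤ (k : ℝ) * dist x y := by positivity
      linarith
    · push Not at hy
      rw [dist_comm] at hy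
      have h1 := (abs_le.1 (hC y)).2
      have h3 : (N : ℝ) ≤ k := by exact_mod_cast hk
      have h4 : (C - c') < N * δ := (div_lt_iff₀ hδ).1 hN
      have h5 : (N : ℝ) * δ ≤ k * dist x y := by gcongr
      linarith
  have hint : Tendsto (fun k => ∫ x, g k x ∂μ) atTop (𝓝 (∫ x, F x ∂μ)) :=
    tendsto_integral_of_dominated_convergence (fun _ => C)
      (fun k => (hcont k).measurable.aestronglyMeasurable) (integrable_const C)
      (fun k => Eventually.of_forall fun x => hgC k x) (Eventually.of_forall hlim)
  obtain ⟨k, hk⟩ := (hint.eventually_lt_const (lt_add_of_pos_right _ hε)).exists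
  exact ⟨g k, hcont k, hFg k, hgC k, hk⟩

/-- Real trigonometric polynomials are boundary values of real parts of entire functions, so these
are dense among the real continuous functions on the circle. -/
lemma exists_entire_re_approx [Fact (0 < 2 * Real.pi)] (g : C(AddCircle (2 * Real.pi), ℝ)) {ε : ℝ}
    (hε : 0 < ε) :
    ∃ P : ℂ → ℂ, Differentiable ℂ P ∧
      ∀ x : AddCircle (2 * Real.pi), |(P (AddCircle.toCircle x)).re - g x| < ε := by
  -- The real part is not `ℂ`-linear, so the induction carries an arbitrary factor `c`.
  have hspan : ∀ f ∈ Submodule.span ℂ (range (fourier (T := 2 * Real.pi))), ∀ c : ℂ,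
      ∃ P : ℂ → ℂ, Differentiable ℂ P ∧
        ∀ x : AddCircle (2 * Real.pi), (P (AddCircle.toCircle x)).re = (c * f x).re := by
    intro f hf
    induction hf using Submodule.span_induction with
    | mem f hf =>
      obtain ⟨k, rfl⟩ := hf
      intro c
      obtain ⟨j, rfl | rfl⟩ := Int.eq_nat_or_neg k
      · refine ⟨fun z => c * z ^ j, by fun_prop, fun x => ?_⟩
        simp [fourier_apply, AddCircle.toCircle_nsmul]
      -- Conjugation leaves the real part unchanged and turns frequency `-j` into `j`.
      · refine ⟨fun z => (starRingEnd ℂ) c * z ^ j, by fun_prop, fun x => ?_⟩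
        rw [fourier_neg, fourier_apply, natCast_zsmul, AddCircle.toCircle_nsmul,
          ← Complex.conj_re]
        simp
    | zero => exact fun c => ⟨fun _ => 0, by fun_prop, fun x => by simp⟩
    | add f₁ f₂ _ _ h₁ h₂ =>
      intro c
      obtain ⟨P₁, hd₁, he₁⟩ := h₁ c
      obtain ⟨P₂, hd₂, he₂⟩ := h₂ c
      refine ⟨fun z => P₁ z + P₂ z, by fun_prop, fun x => ?_⟩
      rw [Complex.add_re, he₁, he₂, ContinuousMap.add_apply, mul_add, Complex.add_re]
    | smul a f _ h =>
      intro c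
      obtain ⟨P, hd, he⟩ := h (c * a)
      exact ⟨P, hd, fun x => by rw [he, ContinuousMap.smul_apply, smul_eq_mul, mul_assoc]⟩
  set G : C(AddCircle (2 * Real.pi), ℂ) := ⟨fun x => (g x : ℂ), by fun_prop⟩ with hG
  have hmem : G ∈ closure (Submodule.span ℂ (range (fourier (T := 2 * Real.pi))) :
      Set C(AddCircle (2 * Real.pi), ℂ)) := by
    rw [← Submodule.topologicalClosure_coe, span_fourier_closure_eq_top]
    trivial
  obtain ⟨f, hf, hfG⟩ := Metric.mem_closure_iff.1 hmem ε hε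
  obtain ⟨P, hd, he⟩ := hspan f hf 1
  refine ⟨P, hd, fun x => ?_⟩
  have h1 : dist (G x) (f x) < ε := (ContinuousMap.dist_apply_le_dist x).trans_lt hfG
  rw [he, one_mul]
  have h2 : (f x).re - g x = (f x - G x).re := by simp [hG]
  rw [h2]
  refine (Complex.abs_re_le_norm _).trans_lt ?_
  rwa [← dist_eq_norm, dist_comm]

lemma upperSemicontinuousOn_sub_continuous {X : Type*} [TopologicalSpace X] {f g : X → ℝ} {s : Set X}
    (hf : UpperSemicontinuousOn f s) (hg : Continuous g) :
    UpperSemicontinuousOn (fun x => f x - g x) s := by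
  simp only [sub_eq_add_neg]
  exact hf.add (hg.neg.upperSemicontinuous.upperSemicontinuousOn s)

/-- The local sub-mean-value inequality implies the one for the whole disc. -/
lemma le_discMean_of_local_submean {w : ℂ → ℝ}
    (hw : UpperSemicontinuousOn w (Metric.closedBall 0 1))
    {C : ℝ} (hC : ∀ z ∈ Metric.closedBall (0 : ℂ) 1, |w z| ≤ C)
    (hloc : ∀ z ∈ Metric.ball (0 : ℂ) 1, ∃ ρ > 0, ∀ s : ℝ, 0 < s → s < ρ →
      w z ≤ discMean w z (s : ℂ)) :
    w 0 ≤ discMean w 0 1 := by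
  have hpi := Real.two_pi_pos
  have : Fact (0 < 2 * Real.pi) := ⟨hpi⟩
  refine le_of_forall_pos_le_add fun ε hε => ?_
  set μ : Measure (AddCircle (2 * Real.pi)) :=
    Measure.map (fun θ : ℝ => (θ : AddCircle (2 * Real.pi)))
      (volume.restrict (Ioc 0 (2 * Real.pi))) with hμ
  have hmeas : Measurable fun θ : ℝ => (θ : AddCircle (2 * Real.pi)) :=
    AddCircle.measurable_mk'
  have hμfin : IsFiniteMeasure μ := Measure.isFiniteMeasure_map _ _
  have hcb : ∀ x : AddCircle (2 * Real.pi),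
      (AddCircle.toCircle x : ℂ) ∈ Metric.closedBall (0 : ℂ) 1 := fun x => by
    rw [mem_closedBall_zero_iff, Circle.norm_coe]
  have hcont : Continuous fun x : AddCircle (2 * Real.pi) => (AddCircle.toCircle x : ℂ) :=
    continuous_subtype_val.comp AddCircle.continuous_toCircle
  have hFusc : UpperSemicontinuous fun x : AddCircle (2 * Real.pi) =>
      w (AddCircle.toCircle x) := by
    rw [← upperSemicontinuousOn_univ_iff]
    exact hw.comp hcont.continuousOn fun x _ => hcb x
  obtain ⟨g, hgc, hFg, hgC, hgint⟩ := exists_continuous_ge_integral_lt μ hFusc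
    (fun x => hC _ (hcb x)) (ε := 2 * Real.pi * (ε / 3)) (by positivity)
  obtain ⟨P, hPd, hPg⟩ := exists_entire_re_approx ⟨g, hgc⟩ (ε := ε / 3) (by positivity)
  have hcoe : ∀ θ : ℝ, (AddCircle.toCircle (θ : AddCircle (2 * Real.pi)) : ℂ) =
      0 + Complex.exp (θ * Complex.I) • (1 : ℂ) := fun θ => by
    rw [AddCircle.toCircle_apply_mk, div_self hpi.ne', one_mul, Circle.coe_exp]
    simp
  have hRe : Continuous fun z => (P z).re := Complex.continuous_re.comp hPd.continuous
  obtain ⟨C', hC'⟩ := (isCompact_closedBall (0 : ℂ) 1).exists_bound_of_continuousOn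
    hRe.continuousOn
  have husc : UpperSemicontinuousOn (fun z => w z - (P z).re) (Metric.closedBall 0 1) :=
    upperSemicontinuousOn_sub_continuous hw hRe
  -- `Re P` has the exact mean value property, so `w - Re P` keeps the local inequality. On the
  -- circle `w ≤ g ≤ Re P + ε / 3`, hence `w 0 ≤ Re P 0 + ε / 3`. The other two thirds of `ε` are
  -- lost in passing from the mean of `Re P` to that of `g`, and from there to that of `w`.
  have hle := le_of_local_submean (w := fun z => w z - (P z).re) (C := C + C') (m := ε / 3) husc
    (fun z hz => (abs_sub _ _).trans (add_le_add (hC z hz) (hC' z hz)))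
    (fun z hz => by
      obtain ⟨ρ, hρ, h⟩ := hloc z hz
      have hz1 : ‖z‖ < 1 := by simpa using hz
      refine ⟨min ρ (1 - ‖z‖), lt_min hρ (by linarith), fun s hs hsρ => ?_⟩
      have hs1 : s < 1 - ‖z‖ := hsρ.trans_le (min_le_right _ _)
      have hcirc : ∀ θ : ℝ,
          z + Complex.exp (θ * Complex.I) • (s : ℂ) ∈ Metric.closedBall (0 : ℂ) 1 := by
        intro θ
        rw [mem_closedBall_zero_iff]
        refine (norm_add_le _ _).trans ?_
        rw [norm_smul, Complex.norm_exp_ofReal_mul_I, Complex.norm_real,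
          Real.norm_of_nonneg hs.le]
        linarith
      have h1 := h s hs (hsρ.trans_le (min_le_left _ _))
      have h2 := discMean_re_of_differentiable hPd z s
      have h3 : discMean (fun z => w z - (P z).re) z s =
          discMean w z s - discMean (fun z => (P z).re) z s := by
        rw [discMean, discMean, discMean, ← mul_sub, integral_sub]
        · exact discMean_integrable hw hC hcirc
        · exact discMean_integrable hRe.continuousOn.upperSemicontinuousOn hC' hcirc
      rw [h3, h2]
      linarith)
    (fun z hz => by
      have hz1 : ‖z‖ = 1 := by simpa using hz
      obtain ⟨x, hx⟩ : ∃ x : AddCircle (2 * Real.pi), (AddCircle.toCircle x : ℂ) = z :=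
        ⟨(Complex.arg z : ℝ), by
          have := Complex.norm_mul_exp_arg_mul_I z
          rw [hz1, Complex.ofReal_one, one_mul] at this
          rw [hcoe, this]
          simp⟩
      have h1 := (abs_lt.1 (hPg x)).1
      have h2 := hFg x
      rw [hx] at h1 h2
      simp only [ContinuousMap.coe_mk] at h1
      linarith) 0 (by simp)
  have h0 := discMean_re_of_differentiable hPd 0 1
  have hgi : IntegrableOn (fun θ : ℝ => g (θ : AddCircle (2 * Real.pi))) (Ioc 0 (2 * Real.pi)) :=
    (((hgc.comp (AddCircle.continuous_mk' _)).integrableOn_Icc (a := 0) (b := 2 * Real.pi)).mono_set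
      Ioc_subset_Icc_self)
  have hPle : discMean (fun z => (P z).re) 0 1 ≤
      (2 * Real.pi)⁻¹ * ∫ θ in Ioc 0 (2 * Real.pi), (g (θ : AddCircle (2 * Real.pi)) + ε / 3) := by
    refine mean_mono (discMean_integrable (Ω := Metric.closedBall (0 : ℂ) 1)
      hRe.continuousOn.upperSemicontinuousOn hC' fun θ => ?_)
      (hgi.add (integrable_const _)) fun θ => ?_
    · rw [← hcoe]; exact hcb _
    · rw [← hcoe]
      have h1 := (abs_lt.1 (hPg θ)).2
      simp only [ContinuousMap.coe_mk] at h1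
      linarith
  rw [integral_add hgi (integrable_const _), mul_add, mean_const] at hPle
  rw [hμ, integral_map hmeas.aemeasurable hgc.measurable.aestronglyMeasurable,
    integral_map hmeas.aemeasurable hFusc.measurable.aestronglyMeasurable] at hgint
  have hgm : (2 * Real.pi)⁻¹ * ∫ θ in Ioc 0 (2 * Real.pi), g (θ : AddCircle (2 * Real.pi)) <
      discMean w 0 1 + ε / 3 := by
    rw [inv_mul_lt_iff₀ hpi, mul_add, discMean, mul_inv_cancel_left₀ hpi.ne']
    simpa only [hcoe] using hgint
  linarith

end OneVariable

/-! ### Bounded plurisubharmonic functions: gluing and maximum principles -/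

section BoundedPsh

variable {E : Type*} [NormedAddCommGroup E] [NormedSpace ℂ E]

/-- Bounded real-valued plurisubharmonic functions. -/
structure IsBddPsh (u : E → ℝ) (Ω : Set E) : Prop where
  usc : UpperSemicontinuousOn u Ω
  bdd : ∃ C, ∀ z ∈ Ω, |u z| ≤ C
  submean : ∀ a b : E, (∀ ζ : ℂ, ‖ζ‖ ≤ 1 → a + ζ • b ∈ Ω) → u a ≤ discMean u a b

/-- Plurisubharmonicity is a local property. -/
lemma IsBddPsh.of_local {u : E → ℝ} {Ω : Set E} (husc : UpperSemicontinuousOn u Ω)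
    (hbdd : ∃ C, ∀ z ∈ Ω, |u z| ≤ C)
    (hloc : ∀ a ∈ Ω, ∀ b : E, ∃ ρ > 0, ∀ s : ℝ, 0 < s → s < ρ → u a ≤ discMean u a ((s : ℂ) • b)) :
    IsBddPsh u Ω := by
  refine ⟨husc, hbdd, fun a b hab => ?_⟩
  obtain ⟨C, hC⟩ := hbdd
  have hmem : ∀ ζ ∈ Metric.closedBall (0 : ℂ) 1, a + ζ • b ∈ Ω := fun ζ hζ =>
    hab ζ (by simpa using hζ)
  have hmean : ∀ z s : ℂ, discMean (fun ζ : ℂ => u (a + ζ • b)) z s =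
      discMean u (a + z • b) (s • b) := by
    intro z s
    simp only [discMean, add_smul, smul_eq_mul, mul_smul, add_assoc]
  have := le_discMean_of_local_submean (w := fun ζ : ℂ => u (a + ζ • b)) (C := C)
    (husc.comp (by fun_prop) hmem) (fun z hz => hC _ (hmem z hz)) (fun z hz => by
      simp only [hmean]
      exact hloc _ (hmem z (Metric.ball_subset_closedBall hz)) b)
  simpa [hmean] using this

lemma IsBddPsh.const (c : ℝ) (Ω : Set E) : IsBddPsh (fun _ => c) Ω :=
  ⟨upperSemicontinuousOn_const, ⟨|c|, fun _ _ => le_rfl⟩, fun _ _ _ => (mean_const c).ge⟩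

lemma IsBddPsh.affine {u : E → ℝ} {Ω : Set E} (hu : IsBddPsh u Ω) {p : ℝ} (hp : 0 ≤ p) (q : ℝ) :
    IsBddPsh (fun z => p * u z + q) Ω := by
  obtain ⟨C, hC⟩ := hu.bdd
  refine ⟨?_, ⟨p * C + |q|, fun z hz => ?_⟩, fun a b hab => ?_⟩
  · intro z hz y hy
    rcases hp.eq_or_lt with rfl | hp
    · simpa using Eventually.of_forall fun _ => by simpa using hy
    · have := hu.usc z hz ((y - q) / p) (show u z < _ by
        rw [lt_div_iff₀ hp]
        have : p * u z + q < y := hy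
        linarith)
      filter_upwards [this] with x hx
      rw [lt_div_iff₀ hp] at hx
      linarith
  · refine (abs_add_le _ _).trans ?_
    rw [abs_mul, abs_of_nonneg hp]
    gcongr
    exact hC z hz
  · have h := hu.submean a b hab
    have hi := discMean_integrable hu.usc hC (circle_mem hab)
    have : discMean (fun z => p * u z + q) a b = p * discMean u a b + q := by
      rw [discMean, integral_add (hi.const_mul p) (integrable_const q), mul_add, mean_const,
        integral_const_mul, discMean]
      ring
    rw [this]
    gcongr

lemma exists_disc_subset {Ω : Set E} (hΩ : IsOpen Ω) {a : E} (ha : a ∈ Ω) (b : E) :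
    ∃ ρ > 0, ∀ s : ℝ, 0 < s → s < ρ → ∀ ζ : ℂ, ‖ζ‖ ≤ 1 → a + ζ • ((s : ℂ) • b) ∈ Ω := by
  obtain ⟨δ, hδ, hball⟩ := Metric.isOpen_iff.1 hΩ a ha
  refine ⟨δ / (‖b‖ + 1), by positivity, fun s hs hsδ ζ hζ => hball ?_⟩
  rw [Metric.mem_ball, dist_self_add_left, norm_smul, norm_smul, Complex.norm_real,
    Real.norm_of_nonneg hs.le]
  rw [lt_div_iff₀ (by positivity)] at hsδ
  calc ‖ζ‖ * (s * ‖b‖) ≤ 1 * (s * ‖b‖) := by gcongr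
    _ ≤ s * (‖b‖ + 1) := by nlinarith
    _ < δ := hsδ

open Classical in
/-- Gluing of bounded plurisubharmonic functions. -/
lemma IsBddPsh.glue {u₁ u₂ : E → ℝ} {Ω U : Set E} (hΩ : IsOpen Ω) (hU : IsOpen U)
    (h₁ : IsBddPsh u₁ Ω) (h₂ : IsBddPsh u₂ Ω) (hle : ∀ z ∈ frontier U, u₂ z ≤ u₁ z) :
    IsBddPsh (fun z => if z ∈ U then u₁ z else max (u₁ z) (u₂ z)) Ω := by
  obtain ⟨C₁, hC₁⟩ := h₁.bdd
  obtain ⟨C₂, hC₂⟩ := h₂.bdd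
  set v : E → ℝ := fun z => if z ∈ U then u₁ z else max (u₁ z) (u₂ z) with hv
  have hvU : ∀ z ∈ U, v z = u₁ z := fun z hz => if_pos hz
  have hvU' : ∀ z ∉ U, v z = max (u₁ z) (u₂ z) := fun z hz => if_neg hz
  have hv1 : ∀ z, u₁ z ≤ v z := fun z => by
    by_cases h : z ∈ U
    · rw [hvU z h]
    · rw [hvU' z h]; exact le_max_left _ _
  have hvmax : ∀ z, v z ≤ max (u₁ z) (u₂ z) := fun z => by
    by_cases h : z ∈ U
    · rw [hvU z h]; exact le_max_left _ _
    · rw [hvU' z h]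
  have husc : UpperSemicontinuousOn v Ω := by
    intro z hz y hy
    by_cases h : z ∈ U
    · rw [hvU z h] at hy
      filter_upwards [h₁.usc z hz y hy, mem_nhdsWithin_of_mem_nhds (hU.mem_nhds h)] with x hx hxU
      rwa [hvU x hxU]
    · rw [hvU' z h, max_lt_iff] at hy
      filter_upwards [h₁.usc z hz y hy.1, h₂.usc z hz y hy.2] with x hx1 hx2
      exact (hvmax x).trans_lt (max_lt hx1 hx2)
  have hbdd : ∀ z ∈ Ω, |v z| ≤ max C₁ C₂ := fun z hz => by
    have a1 := abs_le.1 (hC₁ z hz)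
    have a2 := abs_le.1 (hC₂ z hz)
    have c1 := le_max_left C₁ C₂
    have c2 := le_max_right C₁ C₂
    refine abs_le.2 ⟨?_, (hvmax z).trans (max_le_max a1.2 a2.2)⟩
    linarith [hv1 z]
  refine IsBddPsh.of_local husc ⟨_, hbdd⟩ fun a ha b => ?_
  -- Where `v a = u₁ a`, the inequality for `u₁ ≤ v` suffices. Otherwise `u₁ a < u₂ a`, which the
  -- boundary condition excludes on `closure U`; so `u₂ ≤ v` on small discs about `a`.
  by_cases hva : v a = u₁ a
  · obtain ⟨ρ, hρ, hdisc⟩ := exists_disc_subset hΩ ha b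
    refine ⟨ρ, hρ, fun s hs hsρ => ?_⟩
    rw [hva]
    have hc := hdisc s hs hsρ
    exact (h₁.submean _ _ hc).trans (mean_mono (discMean_integrable h₁.usc hC₁ (circle_mem hc))
      (discMean_integrable husc hbdd (circle_mem hc)) fun θ => hv1 _)
  · have haU : a ∉ U := fun h => hva (hvU a h)
    have hlt : u₁ a < u₂ a := by
      by_contra! h
      exact hva (by rw [hvU' a haU, max_eq_left h])
    have hacl : a ∉ closure U := fun h =>
      absurd (hle a ⟨h, by rwa [hU.interior_eq]⟩) (not_le.2 hlt)
    obtain ⟨ρ, hρ, hdisc⟩ := exists_disc_subset (hΩ.inter isClosed_closure.isOpen_compl)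
      ⟨ha, hacl⟩ b
    refine ⟨ρ, hρ, fun s hs hsρ => ?_⟩
    rw [hvU' a haU, max_eq_right hlt.le]
    have hc := hdisc s hs hsρ
    have hcΩ := fun ζ hζ => (hc ζ hζ).1
    refine (h₂.submean _ _ hcΩ).trans (mean_mono
      (discMean_integrable h₂.usc hC₂ (circle_mem hcΩ))
      (discMean_integrable husc hbdd (circle_mem hcΩ)) fun θ => ?_)
    rw [hvU' _ fun h => (circle_mem hc θ).2 (subset_closure h)]
    exact le_max_right _ _

lemma eventually_disc_subset {Ω : Set E} (hΩ : IsOpen Ω) {a b : E}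
    (hab : ∀ ζ : ℂ, ‖ζ‖ ≤ 1 → a + ζ • b ∈ Ω) :
    ∀ᶠ a' in 𝓝 a, ∀ ζ : ℂ, ‖ζ‖ ≤ 1 → a' + ζ • b ∈ Ω := by
  have hK : IsCompact ((fun ζ : ℂ => a + ζ • b) '' Metric.closedBall 0 1) :=
    (isCompact_closedBall 0 1).image (by fun_prop)
  obtain ⟨δ, hδ, hsub⟩ := hK.exists_thickening_subset_open hΩ (by
    rintro _ ⟨ζ, hζ, rfl⟩
    exact hab ζ (by simpa using hζ))
  filter_upwards [Metric.ball_mem_nhds a hδ] with a' ha' ζ hζ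
  refine hsub (Metric.mem_thickening_iff.2 ⟨a + ζ • b, ⟨ζ, by simpa using hζ, rfl⟩, ?_⟩)
  simpa using ha'

/-- Circle means of a bounded upper semicontinuous function are upper semicontinuous in the centre. -/
lemma eventually_discMean_lt {u : E → ℝ} {Ω : Set E} (hΩ : IsOpen Ω)
    (husc : UpperSemicontinuousOn u Ω) {C : ℝ} (hC : ∀ z ∈ Ω, |u z| ≤ C) {a b : E}
    (hab : ∀ ζ : ℂ, ‖ζ‖ ≤ 1 → a + ζ • b ∈ Ω) {c : ℝ} (hc : discMean u a b < c) :
    ∀ᶠ a' in 𝓝 a, discMean u a' b < c := by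
  have hpi := Real.two_pi_pos
  by_contra hcon
  -- Fatou's lemma for `C - u ≥ 0` along centres `x k → a` whose means stay at least `c`.
  obtain ⟨x, hx, hxp⟩ := exists_seq_forall_of_frequently
    ((not_eventually.1 hcon).and_eventually (eventually_disc_subset hΩ hab))
  have hlint : ∀ y : E, (∀ ζ : ℂ, ‖ζ‖ ≤ 1 → y + ζ • b ∈ Ω) →
      ∫⁻ θ in Ioc 0 (2 * Real.pi),
        ENNReal.ofReal (C - u (y + Complex.exp ((θ : ℝ) * Complex.I) • b)) =
      ENNReal.ofReal (2 * Real.pi * (C - discMean u y b)) := by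
    intro y hy
    have hi := discMean_integrable husc hC (circle_mem hy)
    have hi' : IntegrableOn
        (fun θ : ℝ => C - u (y + Complex.exp ((θ : ℝ) * Complex.I) • b)) (Ioc 0 (2 * Real.pi)) :=
      (integrable_const C).sub hi
    rw [← ofReal_integral_eq_lintegral_ofReal hi' (Eventually.of_forall fun θ => ?_), integral_sub (integrable_const C) hi]
    · congr 1
      rw [mul_sub, discMean, mul_inv_cancel_left₀ hpi.ne']
      conv_rhs => rw [← mean_const C, mul_inv_cancel_left₀ hpi.ne']
    · exact sub_nonneg.2 (abs_le.1 (hC _ (circle_mem hy θ))).2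
  have hfatou : ∫⁻ θ in Ioc 0 (2 * Real.pi),
      ENNReal.ofReal (C - u (a + Complex.exp ((θ : ℝ) * Complex.I) • b)) ≤
      ENNReal.ofReal (2 * Real.pi * (C - c)) := by
    calc _ ≤ ∫⁻ θ in Ioc 0 (2 * Real.pi), liminf (fun k =>
          ENNReal.ofReal (C - u (x k + Complex.exp ((θ : ℝ) * Complex.I) • b))) atTop := by
          refine lintegral_mono fun θ => le_of_forall_lt_imp_le_of_dense fun y hy => ?_
          refine le_liminf_of_le (by isBoundedDefault) ?_
          have hy' := (ENNReal.lt_ofReal_iff_toReal_lt hy.ne_top).1 hy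
          have hev := husc _ (circle_mem hab θ) (C - y.toReal) (by linarith)
          have htend : Tendsto (fun k => x k + Complex.exp ((θ : ℝ) * Complex.I) • b) atTop
              (𝓝[Ω] (a + Complex.exp ((θ : ℝ) * Complex.I) • b)) :=
            tendsto_nhdsWithin_iff.2 ⟨hx.add_const _,
              Eventually.of_forall fun k => circle_mem (hxp k).2 θ⟩
          filter_upwards [htend.eventually hev] with k hk
          exact ((ENNReal.lt_ofReal_iff_toReal_lt hy.ne_top).2 (by linarith)).le
      _ ≤ liminf (fun k => ∫⁻ θ in Ioc 0 (2 * Real.pi),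
          ENNReal.ofReal (C - u (x k + Complex.exp ((θ : ℝ) * Complex.I) • b))) atTop := by
          refine lintegral_liminf_le fun k => ?_
          exact (measurable_const.sub
            (upperSemicontinuous_circle husc (circle_mem (hxp k).2)).measurable).ennreal_ofReal
      _ ≤ _ := by
          refine liminf_le_of_le (by isBoundedDefault) fun y hy => ?_
          obtain ⟨k, hk⟩ := hy.exists
          refine hk.trans ?_
          rw [hlint _ (hxp k).2]
          have := not_lt.1 (hxp k).1
          gcongr
  rw [hlint a hab] at hfatou
  -- `ENNReal.ofReal` truncates at `0`; this bound lets the inequality be read off in the reals.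
  have hlow : c ≤ C := by
    refine (not_lt.1 (hxp 0).1).trans ?_
    rw [← mean_const C]
    exact mean_mono (discMean_integrable husc hC (circle_mem (hxp 0).2)) (integrable_const C)
      fun θ => (abs_le.1 (hC _ (circle_mem (hxp 0).2 θ))).2
  rw [ENNReal.ofReal_le_ofReal_iff (mul_nonneg hpi.le (by linarith)),
    mul_le_mul_iff_right₀ hpi] at hfatou
  linarith

/-- An upper bound on an open ball extends to the boundary points of the ball. -/
lemma IsBddPsh.le_on_closedBall {u : E → ℝ} {Ω : Set E} (hΩ : IsOpen Ω) (hu : IsBddPsh u Ω) {c : E}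
    {R m : ℝ} (hR : 0 < R) (hB : Metric.closedBall c R ⊆ Ω)
    (hle : ∀ z ∈ Metric.ball c R, u z ≤ m) : ∀ z ∈ Metric.closedBall c R, u z ≤ m := by
  have hpi := Real.pi_pos
  intro p hp
  by_contra! hmp
  obtain ⟨C, hC⟩ := hu.bdd
  have hpR : ‖p - c‖ = R := by
    rcases (mem_closedBall_iff_norm.1 hp).lt_or_eq with h | h
    · exact absurd (hle p (mem_ball_iff_norm.2 h)) (not_le.2 hmp)
    · exact h
  -- On a third of a small circle about `p` one has `u ≤ m`, elsewhere `u < u p + ε`. The mean is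
  -- then at most `u p + ε - (u p + ε - m) / 3`, which is below `u p` once `2 * ε < u p - m`.
  set ε : ℝ := (u p - m) / 4 with hε
  have hε0 : 0 < ε := by rw [hε]; linarith
  have hnear : ∀ᶠ z in 𝓝 p, z ∈ Ω ∧ u z < u p + ε := by
    have h1 := hu.usc p (hB hp) (u p + ε) (by linarith)
    rw [hΩ.nhdsWithin_eq (hB hp)] at h1
    exact (hΩ.eventually_mem (hB hp)).and h1
  obtain ⟨V, hVsub, hV, hpV⟩ := mem_nhds_iff.1 hnear
  obtain ⟨ρ, hρ, hdisc⟩ := exists_disc_subset hV hpV (p - c)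
  obtain ⟨s, hs0, hs⟩ := exists_between (lt_min hρ zero_lt_one)
  have hd := hdisc s hs0 (hs.trans_le (min_le_left _ _))
  have hs1 : s < 1 := hs.trans_le (min_le_right _ _)
  have hdΩ : ∀ ζ : ℂ, ‖ζ‖ ≤ 1 → p + ζ • ((s : ℂ) • (p - c)) ∈ Ω := fun ζ hζ => (hVsub (hd ζ hζ)).1
  have hsub := hu.submean _ _ hdΩ
  -- The arc where `cos θ ≤ -1/2`: there `|1 + s e^{iθ}|² ≤ 1 - s + s² < 1`, so the circle runs
  -- inside the open ball.
  set J : Set ℝ := Ioc (2 * Real.pi / 3) (4 * Real.pi / 3) with hJ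
  have hJsub : J ⊆ Ioc 0 (2 * Real.pi) := fun θ hθ => ⟨by have := hθ.1; linarith,
    by have := hθ.2; linarith⟩
  have hcos : ∀ θ ∈ J, Real.cos θ ≤ -(1 / 2) := by
    intro θ hθ
    have h1 : Real.cos θ = -Real.cos (|θ - Real.pi|) := by
      rw [Real.cos_abs, Real.cos_sub_pi, neg_neg]
    have h2 : |θ - Real.pi| ≤ Real.pi / 3 :=
      abs_le.2 ⟨by have := hθ.1; linarith, by have := hθ.2; linarith⟩
    have h3 := Real.cos_le_cos_of_nonneg_of_le_pi (abs_nonneg _) (by linarith) h2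
    rw [Real.cos_pi_div_three] at h3
    linarith
  have hJm : ∀ θ ∈ J, u (p + Complex.exp ((θ : ℝ) * Complex.I) • ((s : ℂ) • (p - c))) ≤ m := by
    intro θ hθ
    refine hle _ (mem_ball_iff_norm.2 ?_)
    have h1 : p + Complex.exp ((θ : ℝ) * Complex.I) • ((s : ℂ) • (p - c)) - c =
        (1 + Complex.exp (θ * Complex.I) * s) • (p - c) := by
      rw [add_smul, one_smul, mul_smul]
      abel
    rw [h1, norm_smul, hpR]
    have h2 : ‖1 + Complex.exp (θ * Complex.I) * s‖ ^ 2 < 1 := by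
      rw [Complex.exp_mul_I, ← Complex.ofReal_cos, ← Complex.ofReal_sin, ← Complex.normSq_eq_norm_sq,
        Complex.normSq_apply]
      simp only [Complex.add_re, Complex.one_re, Complex.mul_re, Complex.ofReal_re, Complex.I_re,
        mul_zero, Complex.ofReal_im, Complex.I_im, mul_one, sub_self, add_zero, Complex.add_im,
        Complex.mul_im, sub_zero, Complex.one_im, zero_add]
      have h3 := Real.sin_sq_add_cos_sq θ
      have h4 := mul_le_mul_of_nonneg_right (hcos θ hθ) hs0.le
      calc _ = 1 + 2 * (Real.cos θ * s) + s ^ 2 * (Real.sin θ ^ 2 + Real.cos θ ^ 2) := by ring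
        _ < 1 := by rw [h3]; nlinarith
    have h3 : ‖1 + Complex.exp (θ * Complex.I) * s‖ < 1 := by
      rwa [sq_lt_one_iff₀ (norm_nonneg _)] at h2
    nlinarith
  have hi : IntegrableOn (J.indicator fun _ : ℝ => u p + ε - m) (Ioc 0 (2 * Real.pi)) :=
    (integrable_const _).indicator measurableSet_Ioc
  have hle' : discMean u p ((s : ℂ) • (p - c)) ≤ (2 * Real.pi)⁻¹ *
      ∫ θ in Ioc 0 (2 * Real.pi), (u p + ε - J.indicator (fun _ : ℝ => u p + ε - m) θ) := by
    refine mean_mono (discMean_integrable hu.usc hC (circle_mem hdΩ))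
      ((integrable_const _).sub hi) fun θ => ?_
    by_cases hθ : θ ∈ J
    · rw [indicator_of_mem hθ]
      linarith [hJm θ hθ]
    · rw [indicator_of_notMem hθ]
      linarith [(hVsub (circle_mem hd θ)).2]
  rw [integral_sub (integrable_const _) hi, mul_sub, mean_const,
    setIntegral_indicator measurableSet_Ioc, inter_eq_self_of_subset_right hJsub,
    setIntegral_const, hJ, Real.volume_real_Ioc_of_le (by linarith), smul_eq_mul] at hle'
  have hval : (2 * Real.pi)⁻¹ * ((4 * Real.pi / 3 - 2 * Real.pi / 3) * (u p + ε - m)) =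
      (u p + ε - m) / 3 := by
    field_simp
    ring
  rw [hval] at hle'
  linarith

/-- Strong maximum principle. -/
lemma IsBddPsh.lt_of_isPreconnected {u : E → ℝ} {Ω : Set E} (hΩ : IsOpen Ω)
    (hconn : IsPreconnected Ω) (hu : IsBddPsh u Ω) {m : ℝ} (hle : ∀ z ∈ Ω, u z ≤ m) {c : E}
    (hc : c ∈ Ω) (hcm : u c < m) : ∀ z ∈ Ω, u z < m := by
  obtain ⟨C, hC⟩ := hu.bdd
  intro z hz
  by_contra! hzm
  have hA : IsOpen {x | x ∈ Ω ∧ u x < m} := by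
    rw [isOpen_iff_mem_nhds]
    rintro x ⟨hx, hxm⟩
    have h1 := hu.usc x hx m hxm
    rw [hΩ.nhdsWithin_eq hx] at h1
    exact (hΩ.eventually_mem hx).and h1
  -- The circle about `a` through `y` meets `y` at `θ = 0`; a value below `m` there would push the
  -- mean below `m`.
  have hB : IsOpen {x | x ∈ Ω ∧ m ≤ u x} := by
    rw [Metric.isOpen_iff]
    rintro a ⟨ha, ham⟩
    obtain ⟨δ, hδ, hball⟩ := Metric.isOpen_iff.1 hΩ a ha
    refine ⟨δ, hδ, fun y hy => ⟨hball hy, ?_⟩⟩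
    by_contra! hym
    have hd : ∀ ζ : ℂ, ‖ζ‖ ≤ 1 → a + ζ • (y - a) ∈ Ω := fun ζ hζ => hball (by
      rw [Metric.mem_ball, dist_self_add_left, norm_smul]
      rw [mem_ball_iff_norm] at hy
      nlinarith [norm_nonneg (y - a)])
    have hlt := integral_lt_of_usc (upperSemicontinuous_circle hu.usc (circle_mem hd))
      (fun θ => hC _ (circle_mem hd θ)) (fun θ => hle _ (circle_mem hd θ)) (θ₀ := 0)
      ⟨le_rfl, Real.two_pi_pos.le⟩ (by simpa using hym)
    exact absurd (ham.trans (hu.submean _ _ hd)) (not_le.2 hlt)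
  obtain ⟨x, -, hx1, hx2⟩ := hconn _ _ hA hB
    (fun x hx => (lt_or_ge (u x) m).imp (fun h => ⟨hx, h⟩) fun h => ⟨hx, h⟩)
    ⟨c, hc, hc, hcm⟩ ⟨z, hz, hz, hzm⟩
  exact absurd hx1.2 (not_lt.2 hx2.2)

end BoundedPsh

/-! ### Passage between extended-real and bounded real functions -/

section ExtendedReal

lemma circleMean_coe {f : ℝ → ℝ} (hf : IntegrableOn f (Ioc 0 (2 * Real.pi))) :
    circleMean (fun θ => (f θ : EReal)) =
      (((2 * Real.pi)⁻¹ * ∫ θ in Ioc 0 (2 * Real.pi), f θ : ℝ) : EReal) := by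
  have h1 : ∫⁻ θ in Ioc 0 (2 * Real.pi), ENNReal.ofReal (f θ) ≠ ⊤ := hf.lintegral_lt_top.ne
  have h2 : ∫⁻ θ in Ioc 0 (2 * Real.pi), ENNReal.ofReal (-f θ) ≠ ⊤ := hf.neg.lintegral_lt_top.ne
  simp only [circleMean, ← EReal.coe_neg, EReal.real_coe_toENNReal]
  rw [integral_eq_lintegral_pos_part_sub_lintegral_neg_part hf, ← EReal.coe_ennreal_toReal h1,
    ← EReal.coe_ennreal_toReal h2, ← EReal.coe_sub, ← EReal.coe_div, inv_mul_eq_div]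

lemma circleMean_mono {f g : ℝ → EReal} (h : ∀ θ, f θ ≤ g θ) : circleMean f ≤ circleMean g := by
  refine EReal.div_le_div_right_of_nonneg (by exact_mod_cast Real.two_pi_pos.le)
    (EReal.sub_le_sub ?_ ?_)
  · exact EReal.coe_ennreal_le_coe_ennreal_iff.2
      (lintegral_mono fun θ => EReal.toENNReal_le_toENNReal (h θ))
  · exact EReal.coe_ennreal_le_coe_ennreal_iff.2
      (lintegral_mono fun θ => EReal.toENNReal_le_toENNReal (EReal.neg_le_neg_iff.2 (h θ)))

variable {n : ℕ} {Ω : Set (EuclideanSpace ℂ (Fin n))}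

/-- A bounded real majorant on the circle turns the extended mean into an ordinary integral. Every
use of the sub-mean inequality of `IsPsh` passes through here, so the value `-∞` needs no further
care. -/
lemma IsPsh.le_discMean {u : EuclideanSpace ℂ (Fin n) → EReal} (hu : IsPsh u Ω)
    {v : EuclideanSpace ℂ (Fin n) → ℝ} (hv : UpperSemicontinuousOn v Ω) {C : ℝ}
    (hC : ∀ z ∈ Ω, |v z| ≤ C) (hle : ∀ z ∈ Ω, u z ≤ v z) {a b : EuclideanSpace ℂ (Fin n)}
    (hab : ∀ ζ : ℂ, ‖ζ‖ ≤ 1 → a + ζ • b ∈ Ω) : u a ≤ (discMean v a b : EReal) := by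
  refine (hu.submean a b hab).trans ?_
  rw [discMean, ← circleMean_coe (discMean_integrable hv hC (circle_mem hab))]
  exact circleMean_mono fun θ => hle _ (circle_mem hab θ)

lemma IsBddPsh.isPsh {v : EuclideanSpace ℂ (Fin n) → ℝ} (hv : IsBddPsh v Ω) :
    IsPsh (fun z => (v z : EReal)) Ω := by
  obtain ⟨C, hC⟩ := hv.bdd
  refine ⟨fun z _ => EReal.coe_lt_top _, fun z hz y hy => ?_, fun a b hab => ?_⟩
  · obtain ⟨x, hx1, hx2⟩ := EReal.lt_iff_exists_real_btwn.1 hy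
    filter_upwards [hv.usc z hz x (EReal.coe_lt_coe_iff.1 hx1)] with w hw
    exact (EReal.coe_lt_coe_iff.2 hw).trans hx2
  · rw [circleMean_coe (discMean_integrable hv.usc hC (circle_mem hab))]
    exact EReal.coe_le_coe_iff.2 (hv.submean a b hab)

lemma coe_toReal_max {x : EReal} (hx : x ≤ 1) (m : ℝ) : (((max x m).toReal : ℝ) : EReal) = max x m := by
  refine EReal.coe_toReal ?_ ?_
  · exact (max_lt (hx.trans_lt (EReal.coe_lt_top 1)) (EReal.coe_lt_top m)).ne
  · exact ((EReal.bot_lt_coe m).trans_le (le_max_right _ _)).ne'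

/-- Truncation from below of a plurisubharmonic function that is bounded above. -/
lemma IsPsh.truncate {u : EuclideanSpace ℂ (Fin n) → EReal} (hu : IsPsh u Ω)
    (h1 : ∀ z ∈ Ω, u z ≤ 1) (m : ℝ) : IsBddPsh (fun z => (max (u z) m).toReal) Ω := by
  have hcoe : ∀ z ∈ Ω, (((max (u z) m).toReal : ℝ) : EReal) = max (u z) m := fun z hz =>
    coe_toReal_max (h1 z hz) m
  have hm : ∀ z ∈ Ω, m ≤ (max (u z) m).toReal := fun z hz => by
    rw [← EReal.coe_le_coe_iff, hcoe z hz]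
    exact le_max_right _ _
  have husc : UpperSemicontinuousOn (fun z => (max (u z) m).toReal) Ω := by
    intro z hz y hy
    have hy' : max (u z) m < y := by
      rw [← hcoe z hz]
      exact EReal.coe_lt_coe_iff.2 hy
    rw [max_lt_iff] at hy'
    filter_upwards [hu.usc z hz y hy'.1, self_mem_nhdsWithin] with w hw hwΩ
    rw [← EReal.coe_lt_coe_iff, hcoe w hwΩ]
    exact max_lt hw hy'.2
  have hbdd : ∀ z ∈ Ω, |(max (u z) m).toReal| ≤ max 1 |m| := fun z hz => by
    refine abs_le.2 ⟨?_, ?_⟩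
    · have := neg_abs_le m
      have := le_max_right 1 |m|
      linarith [hm z hz]
    · rw [← EReal.coe_le_coe_iff, hcoe z hz]
      refine max_le ((h1 z hz).trans ?_) (EReal.coe_le_coe_iff.2 ?_)
      · exact_mod_cast le_max_left 1 |m|
      · exact (le_abs_self m).trans (le_max_right _ _)
  refine ⟨husc, ⟨_, hbdd⟩, fun a b hab => ?_⟩
  have ha : a ∈ Ω := by simpa using hab 0 (by simp)
  rw [← EReal.coe_le_coe_iff, hcoe a ha]
  refine max_le (hu.le_discMean husc hbdd (fun z hz => ?_) hab) (EReal.coe_le_coe_iff.2 ?_)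
  · rw [hcoe z hz]
    exact le_max_left _ _
  · refine (mean_const m).ge.trans ?_
    exact mean_mono (integrable_const m) (discMean_integrable husc hbdd (circle_mem hab))
      fun θ => hm _ (circle_mem hab θ)

end ExtendedReal

/-! ### The relative extremal function and its regularization -/

section RelExtremal

variable {n : ℕ} {Ω K : Set (EuclideanSpace ℂ (Fin n))}

lemma relExtremal_nonpos {z : EuclideanSpace ℂ (Fin n)} (hz : z ∈ Ω) : relExtremal Ω K z ≤ 0 := by
  refine sSup_le ?_
  rintro _ ⟨u, -, hu, -, rfl⟩
  exact (hu z hz).le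

/-- Nonpositive bounded competitors lie below the relative extremal function. -/
lemma IsBddPsh.le_relExtremal {v : EuclideanSpace ℂ (Fin n) → ℝ} (hv : IsBddPsh v Ω)
    (h0 : ∀ z ∈ Ω, v z ≤ 0) (hK : ∀ z ∈ K, v z ≤ -1) (z : EuclideanSpace ℂ (Fin n)) :
    (v z : EReal) ≤ relExtremal Ω K z := by
  -- Competitors must be strictly negative, so `v` is lowered by `v z - y > 0`, with `y < v z`
  -- arbitrary.
  refine EReal.ge_of_forall_gt_iff_ge.1 fun y hy => le_sSup ?_
  have hy' : y < v z := EReal.coe_lt_coe_iff.1 hy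
  refine ⟨fun w => ((1 * v w + (y - v z) : ℝ) : EReal), (hv.affine zero_le_one _).isPsh,
    fun w hw => ?_, fun w hw => ?_, ?_⟩
  · have := h0 w hw
    exact EReal.coe_lt_coe_iff.2 (by linarith : 1 * v w + (y - v z) < 0)
  · have := hK w hw
    exact EReal.coe_le_coe_iff.2 (by linarith : 1 * v w + (y - v z) ≤ -1)
  · simp

lemma neg_one_le_relExtremal (z : EuclideanSpace ℂ (Fin n)) : -1 ≤ relExtremal Ω K z := by
  have := (IsBddPsh.const (-1) Ω).le_relExtremal (K := K) (fun _ _ => by norm_num)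
    (fun _ _ => le_rfl) z
  simpa using this

/-- The upper semicontinuous regularization of the relative extremal function. -/
def extremalReg (Ω K : Set (EuclideanSpace ℂ (Fin n))) (a : EuclideanSpace ℂ (Fin n)) : ℝ :=
  (limsup (relExtremal Ω K) (𝓝 a)).toReal

lemma neg_one_le_limsup_relExtremal (a : EuclideanSpace ℂ (Fin n)) :
    -1 ≤ limsup (relExtremal Ω K) (𝓝 a) :=
  le_limsup_of_frequently_le' (Frequently.of_forall neg_one_le_relExtremal)

lemma limsup_relExtremal_nonpos (hΩ : IsOpen Ω) {a : EuclideanSpace ℂ (Fin n)} (ha : a ∈ Ω) :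
    limsup (relExtremal Ω K) (𝓝 a) ≤ 0 :=
  limsup_le_of_le (by isBoundedDefault)
    ((hΩ.eventually_mem ha).mono fun _ hz => relExtremal_nonpos hz)

lemma coe_extremalReg (hΩ : IsOpen Ω) {a : EuclideanSpace ℂ (Fin n)} (ha : a ∈ Ω) :
    (extremalReg Ω K a : EReal) = limsup (relExtremal Ω K) (𝓝 a) :=
  EReal.coe_toReal ((limsup_relExtremal_nonpos hΩ ha).trans_lt EReal.zero_lt_top).ne
    ((EReal.bot_lt_coe (-1)).trans_le (by simpa using neg_one_le_limsup_relExtremal a)).ne'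

lemma extremalReg_nonpos (hΩ : IsOpen Ω) {a : EuclideanSpace ℂ (Fin n)} (ha : a ∈ Ω) :
    extremalReg Ω K a ≤ 0 := by
  rw [← EReal.coe_le_coe_iff, coe_extremalReg hΩ ha]
  exact limsup_relExtremal_nonpos hΩ ha

lemma neg_one_le_extremalReg (hΩ : IsOpen Ω) {a : EuclideanSpace ℂ (Fin n)} (ha : a ∈ Ω) :
    -1 ≤ extremalReg Ω K a := by
  rw [← EReal.coe_le_coe_iff, coe_extremalReg hΩ ha]
  simpa using neg_one_le_limsup_relExtremal a

/-- The limsup is along `𝓝 a`, not the punctured filter, so the value at `a` counts. -/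
lemma relExtremal_le_extremalReg (hΩ : IsOpen Ω) {a : EuclideanSpace ℂ (Fin n)} (ha : a ∈ Ω) :
    relExtremal Ω K a ≤ extremalReg Ω K a := by
  rw [coe_extremalReg hΩ ha]
  refine le_limsup_of_frequently_le' fun h => ?_
  exact h.self_of_nhds le_rfl

/-- Every competitor is at most `ϱ*`, hence so is its value at `x` compared with the mean of `ϱ*`
about `x`; thus `ϱ x` is at most that mean. Upper semicontinuity of the mean in the centre carries
this to the limsup at `a`. -/
lemma extremalReg_isBddPsh (hΩ : IsOpen Ω) : IsBddPsh (extremalReg Ω K) Ω := by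
  have husc : UpperSemicontinuousOn (extremalReg Ω K) Ω := by
    intro a ha y hy
    have hy' : limsup (relExtremal Ω K) (𝓝 a) < y := by
      rw [← coe_extremalReg hΩ ha]
      exact EReal.coe_lt_coe_iff.2 hy
    obtain ⟨x, hx1, hx2⟩ := EReal.lt_iff_exists_real_btwn.1 hy'
    have hev := eventually_eventually_nhds.2 (eventually_lt_of_limsup_lt hx1)
    rw [hΩ.nhdsWithin_eq ha]
    filter_upwards [hev, hΩ.eventually_mem ha] with w hw hwΩ
    rw [← EReal.coe_lt_coe_iff, coe_extremalReg hΩ hwΩ]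
    exact (limsup_le_of_le (by isBoundedDefault) (hw.mono fun _ h => h.le)).trans_lt hx2
  have hbdd : ∀ z ∈ Ω, |extremalReg Ω K z| ≤ 1 := fun z hz =>
    abs_le.2 ⟨neg_one_le_extremalReg hΩ hz, (extremalReg_nonpos hΩ hz).trans zero_le_one⟩
  refine ⟨husc, ⟨1, hbdd⟩, fun a b hab => ?_⟩
  have ha : a ∈ Ω := by simpa using hab 0 (by simp)
  by_contra! hlt
  obtain ⟨c, hc1, hc2⟩ := exists_between hlt
  rw [← EReal.coe_lt_coe_iff, coe_extremalReg hΩ ha] at hc2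
  obtain ⟨x, hx, hxc, hxd⟩ := ((frequently_lt_of_lt_limsup (by isBoundedDefault)
    hc2).and_eventually ((eventually_discMean_lt hΩ husc hbdd hab hc1).and
      (eventually_disc_subset hΩ hab))).exists
  refine absurd hx (not_lt.2 ?_)
  refine le_trans (sSup_le ?_) (EReal.coe_le_coe_iff.2 hxc.le)
  rintro _ ⟨u, hu, hu0, huK, rfl⟩
  refine hu.le_discMean husc hbdd (fun z hz => ?_) hxd
  have hle : u z ≤ relExtremal Ω K z := le_sSup ⟨u, hu, hu0, huK, rfl⟩
  exact hle.trans (relExtremal_le_extremalReg hΩ hz)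

/-- In the open ball all competitors are at most `-1` near the point, which bounds the limsup; on
the sphere this fails, and `IsBddPsh.le_on_closedBall` takes over. -/
lemma extremalReg_le_neg_one (hΩ : IsOpen Ω) {c : EuclideanSpace ℂ (Fin n)} {R : ℝ} (hR : 0 < R)
    (hB : Metric.closedBall c R ⊆ Ω) :
    ∀ z ∈ Metric.closedBall c R, extremalReg Ω (Metric.closedBall c R) z ≤ -1 := by
  refine (extremalReg_isBddPsh hΩ).le_on_closedBall hΩ hR hB fun z hz => ?_
  rw [← EReal.coe_le_coe_iff, coe_extremalReg hΩ (hB (Metric.ball_subset_closedBall hz))]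
  refine limsup_le_of_le (by isBoundedDefault) ?_
  filter_upwards [Metric.isOpen_ball.mem_nhds hz] with w hw
  refine sSup_le ?_
  rintro _ ⟨u, -, -, huK, rfl⟩
  exact huK w (Metric.ball_subset_closedBall hw)

end RelExtremal

/-! ### The sets `Ω_t` and the improvement by gluing -/

section Inner

variable {n : ℕ} {Ω : Set (EuclideanSpace ℂ (Fin n))}

lemma isOpen_inner (hΩ : IsOpen Ω) (t : ℝ) : IsOpen (inner Ω t) :=
  hΩ.inter (isOpen_lt continuous_const (Metric.continuous_infDist_pt _))

lemma inner_anti {s t : ℝ} (h : s ≤ t) : inner Ω t ⊆ inner Ω s := fun _ hz =>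
  ⟨hz.1, h.trans_lt hz.2⟩

/-- The closure of `Ω_t` keeps distance at least `t > 0` from `∂Ω`, so the gluing takes place inside
`Ω`. -/
lemma frontier_inner_subset (hΩ : IsOpen Ω) {t : ℝ} (ht : 0 < t) :
    frontier (inner Ω t) ⊆ Ω \ inner Ω t := by
  intro z hz
  have hzt : z ∉ inner Ω t := by
    have := hz.2
    rwa [(isOpen_inner hΩ t).interior_eq] at this
  refine ⟨?_, hzt⟩
  have hdist : t ≤ Metric.infDist z (frontier Ω) :=
    closure_minimal (fun w hw => hw.2.le)
      (isClosed_le continuous_const (Metric.continuous_infDist_pt (frontier Ω))) hz.1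
  by_contra hzΩ
  have hfr : z ∈ frontier Ω :=
    ⟨closure_mono (fun w hw => hw.1) hz.1, by rwa [hΩ.interior_eq]⟩
  rw [Metric.infDist_zero_of_mem hfr] at hdist
  linarith

/-- Keeps the suprema and infima over `Ω \ Ω_t` from being taken over the empty set. -/
lemma diff_inner_nonempty (hne : (frontier Ω).Nonempty) {t : ℝ} (ht : 0 < t) :
    (Ω \ inner Ω t).Nonempty := by
  obtain ⟨p, hp⟩ := hne
  obtain ⟨z, hz, hzp⟩ := Metric.mem_closure_iff.1 hp.1 t ht
  refine ⟨z, hz, fun h => ?_⟩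
  have := Metric.infDist_le_dist_of_mem (x := z) hp
  rw [dist_comm] at hzp
  linarith [h.2]

/-- Gluing a multiple of `ψ - 1` to the relative extremal function near the boundary improves its
lower bound there. -/
lemma relExtremal_ge_of_gap (hΩ : IsOpen Ω) {c : EuclideanSpace ℂ (Fin n)} {R : ℝ} (hR : 0 < R)
    (hB : Metric.closedBall c R ⊆ Ω) {s t : ℝ} (ht : 0 < t) (hst : s ≤ t)
    (hBt : Metric.closedBall c R ⊆ inner Ω t) {ψ : EuclideanSpace ℂ (Fin n) → EReal}
    (hψ : IsPsh ψ Ω) (hψ1 : ∀ z ∈ Ω, ψ z ≤ 1) {S I M : ℝ} (hS1 : S < 1)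
    (hS : ∀ z ∈ frontier (inner Ω t), ψ z ≤ S) (hI : ∀ z ∈ Ω \ inner Ω s, I ≤ ψ z) (hM : 0 ≤ M)
    (hρ : ∀ z ∈ Ω \ inner Ω t, ((-M : ℝ) : EReal) ≤ relExtremal Ω (Metric.closedBall c R) z) :
    ∀ z ∈ Ω \ inner Ω s, ((-(M * ((1 - I) / (1 - S))) : ℝ) : EReal) ≤
      relExtremal Ω (Metric.closedBall c R) z := by
  classical
  have hS0 : 0 < 1 - S := by linarith
  have hp : 0 ≤ M / (1 - S) := by positivity
  set u₁ := extremalReg Ω (Metric.closedBall c R) with hu₁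
  -- Truncation at `S` makes `ψ` real and bounded without spoiling `ψ ≤ S` on `∂Ω_t`.
  set φ : EuclideanSpace ℂ (Fin n) → ℝ := fun z => (max (ψ z) S).toReal with hφ
  have hφcoe : ∀ z ∈ Ω, (φ z : EReal) = max (ψ z) S := fun z hz => coe_toReal_max (hψ1 z hz) S
  set u₂ : EuclideanSpace ℂ (Fin n) → ℝ := fun z => M / (1 - S) * φ z + -(M / (1 - S)) with hu₂
  have hu₂psh : IsBddPsh u₂ Ω := (hψ.truncate hψ1 S).affine hp _
  have hfr : ∀ z ∈ frontier (inner Ω t), u₂ z ≤ u₁ z := by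
    intro z hz
    have hzΩ := frontier_inner_subset hΩ ht hz
    have h1 : -M ≤ u₁ z := by
      rw [← EReal.coe_le_coe_iff]
      exact (hρ z hzΩ).trans (relExtremal_le_extremalReg hΩ hzΩ.1)
    have h2 : φ z ≤ S := by
      rw [← EReal.coe_le_coe_iff, hφcoe z hzΩ.1]
      exact max_le (hS z hz) le_rfl
    have h3 : M / (1 - S) * φ z ≤ M / (1 - S) * S := by gcongr
    have h4 : M / (1 - S) * S + -(M / (1 - S)) = -M := by
      field_simp
      ring
    simp only [hu₂]
    linarith
  have hv := (extremalReg_isBddPsh (K := Metric.closedBall c R) hΩ).glue hΩ (isOpen_inner hΩ t)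
    hu₂psh hfr
  intro z hz
  have hcomp := hv.le_relExtremal (K := Metric.closedBall c R) (fun w hw => ?_) (fun w hw => ?_) z
  · refine le_trans (EReal.coe_le_coe_iff.2 ?_) hcomp
    rw [if_neg fun h => hz.2 (inner_anti hst h)]
    refine le_trans ?_ (le_max_right _ _)
    have h2 : I ≤ φ z := by
      rw [← EReal.coe_le_coe_iff, hφcoe z hz.1]
      exact (hI z hz).trans (le_max_left _ _)
    have h3 : M / (1 - S) * I ≤ M / (1 - S) * φ z := by gcongr
    have h4 : -(M * ((1 - I) / (1 - S))) = M / (1 - S) * I + -(M / (1 - S)) := by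
      field_simp
      ring
    simp only [hu₂]
    linarith
  · have h1 : φ w ≤ 1 := by
      rw [← EReal.coe_le_coe_iff, hφcoe w hw]
      exact max_le (hψ1 w hw) (EReal.coe_le_coe_iff.2 hS1.le)
    have h2 : u₂ w ≤ 0 := by
      have : M / (1 - S) * φ w ≤ M / (1 - S) * 1 := by gcongr
      simp only [hu₂]
      linarith
    have h0 := extremalReg_nonpos (K := Metric.closedBall c R) hΩ hw
    split_ifs
    · exact h0
    · exact max_le h0 h2
  · rw [if_pos (hBt hw)]
    exact extremalReg_le_neg_one hΩ hR hB w hw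

end Inner

/-! ### Integrating the logarithmic inequality -/

section Calculus

lemma log_integral_bound {M κ : ℝ → ℝ} {α r r₀ : ℝ} (hα₀ : 0 < α) (hα₁ : α < 1) (hr : 0 < r)
    (hrr₀ : r / α < r₀) (hmono : MonotoneOn M (Ioi 0)) (hM0 : ∀ t, 0 < t → 0 < M t)
    (hM1 : ∀ t, 0 < t → M t ≤ 1)
    (hstep : ∀ t, r / α ≤ t → t ≤ r₀ → M (α * t) ≤ M t * (1 - κ t))
    (hint : IntervalIntegrable (fun t => κ t / t) volume (r / α) r₀) :
    M r ≤ Real.exp (-(1 / Real.log (1 / α)) * ∫ t in (r / α)..r₀, κ t / t) := by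
  have hra : 0 < r / α := by positivity
  have hr₀ : 0 < r₀ := hra.trans hrr₀
  have hlog : 0 < Real.log (1 / α) := Real.log_pos (by rw [lt_div_iff₀ hα₀]; linarith)
  set G : ℝ → ℝ := fun t => Real.log (M t) * t⁻¹ with hG
  have hL : MonotoneOn (fun t => Real.log (M t)) (Ioi 0) := fun x hx y hy hxy =>
    Real.log_le_log (hM0 x hx) (hmono hx hy hxy)
  have hsub : ∀ x y : ℝ, 0 < x → 0 < y → uIcc x y ⊆ Ioi 0 := fun x y hx hy z hz =>
    (lt_min hx hy).trans_le hz.1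
  have hinv : ∀ x y : ℝ, 0 < x → 0 < y → ContinuousOn (fun t : ℝ => t⁻¹) (uIcc x y) :=
    fun x y hx hy => continuousOn_inv₀.mono fun z hz => (hsub x y hx hy hz).ne'
  -- Monotonicity of `log M` is enough for integrability; `M` need not be continuous.
  have hGi : ∀ x y : ℝ, 0 < x → 0 < y → IntervalIntegrable G volume x y := fun x y hx hy =>
    ((hL.mono (hsub x y hx hy)).intervalIntegrable).mul_continuousOn (hinv x y hx hy)
  have hLα : IntervalIntegrable (fun t => α * G (α * t)) volume (r / α) r₀ := by
    have h1 : MonotoneOn (fun t => Real.log (M (α * t))) (uIcc (r / α) r₀) := fun x hx y hy hxy =>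
      hL (mul_pos hα₀ (hsub _ _ hra hr₀ hx)) (mul_pos hα₀ (hsub _ _ hra hr₀ hy))
        (by gcongr)
    refine (h1.intervalIntegrable.mul_continuousOn (hinv _ _ hra hr₀)).congr fun t _ => ?_
    simp only [hG, mul_inv]
    field_simp
  have hpt : ∀ t ∈ Icc (r / α) r₀, κ t / t ≤ G t - α * G (α * t) := by
    intro t ht
    have ht0 : 0 < t := hra.trans_le ht.1
    have h1 := hstep t ht.1 ht.2
    have h2 := hM0 t ht0
    have h3 := hM0 (α * t) (by positivity)
    -- Forced by `0 < M (α * t) ≤ M t * (1 - κ t)`.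
    have h4 : 0 < 1 - κ t := by
      by_contra! h
      nlinarith
    have h5 := Real.log_le_log h3 h1
    rw [Real.log_mul h2.ne' h4.ne'] at h5
    have h6 := Real.log_le_sub_one_of_pos h4
    have h7 : G t - α * G (α * t) = (Real.log (M t) - Real.log (M (α * t))) / t := by
      simp only [hG]
      field_simp
    rw [h7]
    gcongr
    linarith
  have h1 : ∫ t in (r / α)..r₀, κ t / t ≤ ∫ t in (r / α)..r₀, (G t - α * G (α * t)) :=
    intervalIntegral.integral_mono_on hrr₀.le hint ((hGi _ _ hra hr₀).sub hLα) hpt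
  -- Substituting `α * t` for `t` moves the second integral to `[r, α * r₀]`; after cancellation the
  -- integral of `G` over `[α * r₀, r₀]` minus that over `[r, r / α]` remains.
  rw [intervalIntegral.integral_sub (hGi _ _ hra hr₀) hLα, intervalIntegral.integral_const_mul,
    intervalIntegral.mul_integral_comp_mul_left, mul_div_cancel₀ _ hα₀.ne',
    intervalIntegral.integral_interval_sub_interval_comm (hGi _ _ hra hr₀)
      (hGi _ _ hr (by positivity)) (hGi _ _ hra hr), intervalIntegral.integral_symm r,
    intervalIntegral.integral_symm (α * r₀)] at h1
  have h2 : ∫ t in (α * r₀)..r₀, G t ≤ 0 := by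
    rw [← neg_nonneg, ← intervalIntegral.integral_neg]
    refine intervalIntegral.integral_nonneg (by nlinarith) fun t ht => ?_
    have ht0 : 0 < t := lt_of_lt_of_le (by positivity) ht.1
    have := Real.log_nonpos (hM0 t ht0).le (hM1 t ht0)
    rw [neg_nonneg]
    exact mul_nonpos_of_nonpos_of_nonneg this (by positivity)
  have h3 : Real.log (M r) * Real.log (1 / α) ≤ ∫ t in r..(r / α), G t := by
    have hrle : r ≤ r / α := by rw [le_div_iff₀ hα₀]; nlinarith
    have : ∫ t in r..(r / α), Real.log (M r) * t⁻¹ = Real.log (M r) * Real.log (1 / α) := by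
      rw [intervalIntegral.integral_const_mul, integral_inv_of_pos hr hra]
      congr 2
      field_simp
    rw [← this]
    refine intervalIntegral.integral_mono_on hrle ?_ (hGi _ _ hr hra) fun t ht => ?_
    · exact ((hinv _ _ hr hra).intervalIntegrable).const_mul _
    · have ht0 : 0 < t := hr.trans_le ht.1
      have := hL hr ht0 ht.1
      simp only [hG] at this ⊢
      gcongr
  rw [← Real.log_le_iff_le_exp (hM0 r hr), neg_mul, one_div_mul_eq_div, le_neg, div_le_iff₀ hlog]
  linarith

end Calculus

end

end PSH

/-! ### The decay estimate -/

theorem lemma2p1 {n : ℕ} (Ω : Set (EuclideanSpace ℂ (Fin n)))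
    (hΩ_open : IsOpen Ω) (hΩ_conn : IsConnected Ω) (hΩ_bdd : Bornology.IsBounded Ω)
    (hΩ_psc : PSH.IsPseudoconvex Ω)
    (c : EuclideanSpace ℂ (Fin n)) (R : ℝ) (hR : 0 < R) (hB : Metric.closedBall c R ⊆ Ω)
    (α t₀ : ℝ) (hα₀ : 0 < α) (hα₁ : α < 1)
    (ψ : ℝ → EuclideanSpace ℂ (Fin n) → EReal)
    (hψ_psh : ∀ t, 0 < t → t ≤ t₀ → PSH.IsPsh (ψ t) Ω)
    (hψ_sup : ∀ t, 0 < t → t ≤ t₀ → (⨆ z ∈ Ω, ψ t z) < 1)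
    (hψ_gap : ∀ t, 0 < t → t ≤ t₀ → PSH.bdrySup Ω ψ t < PSH.outerInf Ω α ψ t)
    (r r₀ : ℝ) (hr : 0 < r) (hrr₀ : r / α < r₀) (hr₀ : r₀ ≤ t₀)
    (hBr₀ : Metric.closedBall c R ⊆ PSH.inner Ω r₀)
    (hκ : AEMeasurable (PSH.kappa Ω α ψ)
      (MeasureTheory.volume.restrict (Set.Ioc (r / α) r₀))) :
    IntervalIntegrable (fun t => PSH.kappa Ω α ψ t / t) MeasureTheory.volume (r / α) r₀ ∧
    (⨆ z ∈ Ω \ PSH.inner Ω r, -PSH.relExtremal Ω (Metric.closedBall c R) z) ≤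
      ((Real.exp (-(1 / Real.log (1 / α)) *
        ∫ t in (r / α)..r₀, PSH.kappa Ω α ψ t / t) : ℝ) : EReal) := by
  have hra : 0 < r / α := by positivity
  have hr₀pos : 0 < r₀ := hra.trans hrr₀
  have hcB : c ∈ Metric.closedBall c R := Metric.mem_closedBall_self hR.le
  -- The distance to an empty frontier is `0` by convention, which would make `Ω_{r₀}` empty.
  have hfr : (frontier Ω).Nonempty := by
    by_contra h
    have h1 := (hBr₀ hcB).2
    rw [Set.not_nonempty_iff_eq_empty.1 h, Metric.infDist_empty] at h1
    linarith
  set K := Metric.closedBall c R with hK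
  set ρ := PSH.relExtremal Ω K with hρ
  have hψ1 : ∀ t, 0 < t → t ≤ r₀ → ∀ z ∈ Ω, ψ t z < 1 := fun t ht htr z hz =>
    (le_iSup₂ (f := fun z (_ : z ∈ Ω) => ψ t z) z hz).trans_lt (hψ_sup t ht (htr.trans hr₀))
  have hneg : ∀ z ∈ Ω, PSH.extremalReg Ω K z < 0 :=
    (PSH.extremalReg_isBddPsh hΩ_open).lt_of_isPreconnected hΩ_open hΩ_conn.isPreconnected
      (fun z hz => PSH.extremalReg_nonpos hΩ_open hz) (hB hcB)
      ((PSH.extremalReg_le_neg_one hΩ_open hR hB c hcB).trans_lt (by norm_num))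
  set D : ℝ → ℝ := fun t => (⨆ z ∈ Ω \ PSH.inner Ω t, -ρ z).toReal with hD
  have hDcoe : ∀ t, 0 < t → (D t : EReal) = ⨆ z ∈ Ω \ PSH.inner Ω t, -ρ z := by
    intro t ht
    obtain ⟨z, hz⟩ := PSH.diff_inner_nonempty hfr ht
    refine EReal.coe_toReal (ne_of_lt ?_) (ne_of_gt ?_)
    · refine lt_of_le_of_lt (iSup₂_le fun w hw => ?_) (EReal.coe_lt_top 1)
      exact EReal.neg_le_of_neg_le (PSH.neg_one_le_relExtremal w)
    · refine lt_of_lt_of_le ?_ (le_iSup₂ (f := fun z (_ : z ∈ Ω \ PSH.inner Ω t) => -ρ z) z hz)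
      refine EReal.bot_lt_zero.trans_le ?_
      rw [EReal.le_neg, neg_zero]
      exact PSH.relExtremal_nonpos hz.1
  have hDge : ∀ t, 0 < t → ∀ z ∈ Ω \ PSH.inner Ω t, ((-D t : ℝ) : EReal) ≤ ρ z := by
    intro t ht z hz
    rw [EReal.coe_neg, EReal.neg_le, hDcoe t ht]
    exact le_iSup₂ (f := fun z (_ : z ∈ Ω \ PSH.inner Ω t) => -ρ z) z hz
  have hDle : ∀ t, 0 < t → ∀ M : ℝ,
      (∀ z ∈ Ω \ PSH.inner Ω t, ((-M : ℝ) : EReal) ≤ ρ z) → D t ≤ M := by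
    intro t ht M h
    rw [← EReal.coe_le_coe_iff, hDcoe t ht]
    refine iSup₂_le fun z hz => ?_
    rw [EReal.neg_le, ← EReal.coe_neg]
    exact h z hz
  have hD0 : ∀ t, 0 < t → 0 < D t := by
    intro t ht
    obtain ⟨z, hz⟩ := PSH.diff_inner_nonempty hfr ht
    have h1 := (hDge t ht z hz).trans (PSH.relExtremal_le_extremalReg hΩ_open hz.1)
    rw [EReal.coe_le_coe_iff] at h1
    linarith [hneg z hz.1]
  have hD1 : ∀ t, 0 < t → D t ≤ 1 := fun t ht => hDle t ht 1 fun z _ =>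
    PSH.neg_one_le_relExtremal z
  have hDmono : MonotoneOn D (Set.Ioi 0) := fun x hx y hy hxy => hDle x hx _ fun z hz =>
    hDge y hy z ⟨hz.1, fun h => hz.2 (PSH.inner_anti hxy h)⟩
  -- Stated for real bounds `S` and `I` rather than the extrema, so that it also applies before
  -- these are known to be finite.
  have hgap : ∀ t, 0 < t → t ≤ r₀ → ∀ S I : ℝ, S < 1 → PSH.bdrySup Ω ψ t ≤ S →
      I ≤ PSH.outerInf Ω α ψ t → D (α * t) ≤ D t * ((1 - I) / (1 - S)) := by
    intro t ht htr S I hS1 hS hI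
    refine hDle _ (by positivity) _ ?_
    refine PSH.relExtremal_ge_of_gap hΩ_open hR hB ht (by nlinarith)
      (hBr₀.trans (PSH.inner_anti htr)) (hψ_psh t ht (htr.trans hr₀))
      (fun z hz => (hψ1 t ht htr z hz).le) hS1 (fun z hz => ?_) (fun z hz => ?_) (hD0 t ht).le
      (hDge t ht)
    · exact (le_iSup₂ (f := fun z (_ : z ∈ frontier (PSH.inner Ω t)) => ψ t z) z hz).trans hS
    · exact hI.trans (iInf₂_le (f := fun z (_ : z ∈ Ω \ PSH.inner Ω (α * t)) => ψ t z) z hz)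
  have hI1 : ∀ t, 0 < t → t ≤ r₀ → PSH.outerInf Ω α ψ t < 1 := by
    intro t ht htr
    obtain ⟨z, hz⟩ := PSH.diff_inner_nonempty hfr (mul_pos hα₀ ht)
    exact (iInf₂_le (f := fun z (_ : z ∈ Ω \ PSH.inner Ω (α * t)) => ψ t z) z hz).trans_lt
      (hψ1 t ht htr z hz.1)
  -- If the supremum were `-∞`, `hgap` would hold with `S = 1 - q` for every `q > 0`. The `q` below
  -- makes its right side smaller than `D (α * t) > 0`.
  have hSbot : ∀ t, 0 < t → t ≤ r₀ → PSH.bdrySup Ω ψ t ≠ ⊥ := by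
    intro t ht htr hbot
    obtain ⟨I, -, hI⟩ := EReal.lt_iff_exists_real_btwn.1 (hψ_gap t ht (htr.trans hr₀))
    have hIlt : I < 1 := EReal.coe_lt_coe_iff.1 (hI.trans (hI1 t ht htr))
    have hDα := hD0 (α * t) (by positivity)
    have hDt := hD0 t ht
    have hA : 0 < D t * (1 - I) + 1 := by nlinarith
    set q : ℝ := (D t * (1 - I) + 1) / D (α * t) with hq
    have hq0 : 0 < q := by positivity
    have h := hgap t ht htr (1 - q) I (by linarith) (hbot ▸ bot_le) hI.le
    rw [sub_sub_cancel, ← mul_div_assoc, le_div_iff₀ hq0, hq, mul_div_cancel₀ _ hDα.ne'] at h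
    linarith
  have hfin : ∀ t, 0 < t → t ≤ r₀ → ∃ S I : ℝ, PSH.bdrySup Ω ψ t = S ∧
      PSH.outerInf Ω α ψ t = I ∧ S < I ∧ I < 1 ∧ PSH.kappa Ω α ψ t = (I - S) / (1 - S) := by
    intro t ht htr
    have hg := hψ_gap t ht (htr.trans hr₀)
    have h1 := EReal.coe_toReal (hg.trans_le le_top).ne (hSbot t ht htr)
    have h2 := EReal.coe_toReal ((hI1 t ht htr).trans (EReal.coe_lt_top 1)).ne
      (bot_le.trans_lt hg).ne'
    refine ⟨_, _, h1.symm, h2.symm, ?_, ?_, rfl⟩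
    · rwa [← EReal.coe_lt_coe_iff, h1, h2]
    · rw [← EReal.coe_lt_coe_iff, h2]
      exact hI1 t ht htr
  have hκ01 : ∀ t, 0 < t → t ≤ r₀ → 0 ≤ PSH.kappa Ω α ψ t ∧ PSH.kappa Ω α ψ t ≤ 1 := by
    intro t ht htr
    obtain ⟨S, I, -, -, hSI, hI, hk⟩ := hfin t ht htr
    rw [hk]
    exact ⟨div_nonneg (by linarith) (by linarith), (div_le_one (by linarith)).2 (by linarith)⟩
  have hint : IntervalIntegrable (fun t => PSH.kappa Ω α ψ t / t) volume (r / α) r₀ := by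
    rw [intervalIntegrable_iff_integrableOn_Ioc_of_le hrr₀.le]
    refine Integrable.of_bound (hκ.div aemeasurable_id).aestronglyMeasurable (1 / (r / α)) ?_
    refine ae_restrict_of_forall_mem measurableSet_Ioc fun t ht => ?_
    have ht0 : 0 < t := hra.trans ht.1
    obtain ⟨h1, h2⟩ := hκ01 t ht0 ht.2
    rw [Real.norm_of_nonneg (div_nonneg h1 ht0.le)]
    exact div_le_div₀ zero_le_one h2 hra ht.1.le
  refine ⟨hint, ?_⟩
  rw [← hDcoe r hr, EReal.coe_le_coe_iff]
  refine PSH.log_integral_bound hα₀ hα₁ hr hrr₀ hDmono hD0 hD1 (fun t ht htr => ?_) hint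
  have ht0 : 0 < t := hra.trans_le ht
  obtain ⟨S, I, hS, hI, hSI, hI1, hk⟩ := hfin t ht0 htr
  have h := hgap t ht0 htr S I (by linarith) hS.le hI.ge
  rwa [hk, one_sub_div (by linarith), sub_sub_sub_cancel_right]
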